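/- Let $p\in\{2,3\}$, let $\Omega\subset\mathbb R^p$ be a bounded simply connected domain with boundary $\Gamma$ and unit outward normal $\mathbf n$, and let $\omega,\mu_0,\varepsilon_0>0$, $k=\omega\sqrt{\mu_0\varepsilon_0}$. Put $q=1$ if $p=2$ and $q=3$ if $p=3$; for $p=2$, $\mathbf u\times\mathbf v=u_1v_2-u_2v_1$ and $\operatorname{curl}\mathbf u=\partial_1u_2-\partial_2u_1$. **Spaces.** Let $H(\operatorname{curl})=\{\mathbf u\in L^2(\Omega)^p:\operatorname{curl}\mathbf u\in L^2(\Omega)^q\}$ (complex-valued fields, weak curl) with the graph norm. Let $H^{1/2}(\Gamma)=H^1(\Omega)/H^1_0(\Omega)$ be the space of boundary values of $H^1(\Omega)$ with the quotient norm, and $H^{-1/2}(\Gamma)$ its antidual. The tangential trace $\gamma_t(\mathbf u)=\mathbf u|_\Gamma\times\mathbf n\in H^{-1/2}(\Gamma)^q$ of $\mathbf u\in H(\operatorname{curl})$ is defined by Green's formula $$\langle\gamma_t(\mathbf u),\varphi\rangle=\int_\Omega\big(\mathbf u\cdot\overline{\operatorname{curl}\varphi}-\operatorname{curl}\mathbf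 u\cdot\overline{\varphi}\big)\,dx,\qquad \varphi\in H^1(\Omega)^q$$ (with $\operatorname{curl}\varphi=(\partial_2\varphi,-\partial_1\varphi)$ if $p=2$); when $\Gamma$ is Lipschitz this is the continuous extension of $\mathbf u\mapsto\mathbf u|_\Gamma\times\mathbf n$. Let $Y(\Gamma)=\gamma_t(H(\operatorname{curl}))$ with the norm $\|\mathbf f\|_{Y(\Gamma)}=\inf\{\|\mathbf u\|_{H(\operatorname{curl})}:\gamma_t(\mathbf u)=\mathbf f\}$, and let $Y(\Gamma)'$ be its antidual. **Refractive indices.** A function $\kappa:\Omega\to\mathbb C$ is an *admissible* refractive index if $\kappa=\frac1{\varepsilon_0}\big(\varepsilon+i\frac{\sigma}{\omega}\big)$ with real functions $\varepsilon,\sigma\in L^\infty(\Omega)$ such that $\varepsilon\ge\tilde\varepsilon$ and $\sigma\ge\tilde\sigma$ almost everywhere in $\Omega$ for some constants $\tilde\varepsilon,\tilde\sigma>0$. Fix a function $\kappa_0$ and a measurable set $D$, and put $\kappa_a=\kappa_0(1+a\chi_D)$ for $a\in\mathbb R$. **Direct problem.** Fix $\mathbf g_N\in Y(\Gamma)'$.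 For an admissible $\kappa$, $\mathbf E[\kappa]\in H(\operatorname{curl})$ denotes the weak solution of $\operatorname{curl}\operatorname{curl}\mathbf E-k^2\kappa\mathbf E=0$ in $\Omega$, $\operatorname{curl}\mathbf E\times\mathbf n=\mathbf g_N$ on $\Gamma$, that is, $$(\operatorname{curl}\mathbf E[\kappa],\operatorname{curl}\boldsymbol\varphi)-k^2(\kappa\mathbf E[\kappa],\boldsymbol\varphi)=\langle\mathbf g_N,\boldsymbol\varphi_T\rangle_\Gamma\qquad\text{for all }\boldsymbol\varphi\in H(\operatorname{curl}),$$ where $(\cdot,\cdot)$ is the $L^2(\Omega)$ product and $\langle\cdot,\cdot\rangle_\Gamma$ the bracket of $Y(\Gamma)'$ and $Y(\Gamma)$; here the tangential component $\boldsymbol\varphi_T=\mathbf n\times(\boldsymbol\varphi\times\mathbf n)$ is identified with $\gamma_t(\boldsymbol\varphi)=\boldsymbol\varphi\times\mathbf n$, to which it corresponds by a rotation by a right angle in the tangent plane. **Statement.** Let $I\subset\mathbb R$ be an open interval such that $\kappa_a$ is admissible for all $a\in I$. Then for every $a\in I$ the direct problem with $\kappa=\kappa_a$ has exactly one solution $\mathbf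 E[\kappa_a]$, the map $K:a\mapsto\mathbf E[\kappa_a]$ is $\mathcal C^\infty$ from $I$ into $H(\operatorname{curl})$, the map $K_t:a\mapsto\gamma_t(\mathbf E[\kappa_a])$ is $\mathcal C^\infty$ from $I$ into $Y(\Gamma)$, and for all $a\in I$ and $n\in\mathbb N$ $$K_t^{(n)}(a)=\gamma_t\big(K^{(n)}(a)\big).$$ -/

import Mathlib

open MeasureTheory
open scoped ContDiff InnerProductSpace

noncomputable section

namespace Maxwell

/-! ### Space dimension, cross product -/

/-- The space dimension `p`: two or three. -/
inductive SpaceDim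
  | two
  | three

/-- The dimension `p` of the ambient space. -/
def SpaceDim.dim : SpaceDim → ℕ
  | .two => 2
  | .three => 3

/-- The number of components of `curl u` and of `u × n` for a vector field `u` of `ℝ^p`:
one in the plane (scalar curl), three in space. -/
def SpaceDim.curlDim : SpaceDim → ℕ
  | .two => 1
  | .three => 3

/-- The ambient space `ℝ^p`. -/
abbrev Space (d : SpaceDim) : Type := EuclideanSpace ℝ (Fin d.dim)

/-- Values of (complex) vector fields: `ℂ^p`. -/
abbrev Vec (d : SpaceDim) : Type := EuclideanSpace ℂ (Fin d.dim)

/-- Values of the curl and of the tangential trace of a vector field: `ℂ` (that is, `ℂ^1`) in the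
plane, `ℂ^3` in space. -/
abbrev CurlVec (d : SpaceDim) : Type := EuclideanSpace ℂ (Fin d.curlDim)

/-- The cross product: `u × v = u₁ v₂ - u₂ v₁` in the plane, the usual one in space. -/
def cross : (d : SpaceDim) → (Fin d.dim → ℂ) → (Fin d.dim → ℂ) → (Fin d.curlDim → ℂ)
  | .two => fun (u v : Fin 2 → ℂ) (_ : Fin 1) => u 0 * v 1 - u 1 * v 0
  | .three => fun (u v : Fin 3 → ℂ) => crossProduct u v

theorem cross_add (d : SpaceDim) (u v w : Fin d.dim → ℂ) :
    cross d u (v + w) = cross d u v + cross d u w := by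
  cases d
  · have h (u v w : Fin 2 → ℂ) : (fun _ : Fin 1 => u 0 * (v + w) 1 - u 1 * (v + w) 0) =
        (fun _ : Fin 1 => u 0 * v 1 - u 1 * v 0) + (fun _ : Fin 1 => u 0 * w 1 - u 1 * w 0) := by
      funext i
      simp only [Pi.add_apply]
      ring
    exact h u v w
  · exact map_add (crossProduct (R := ℂ) u) v w

theorem cross_smul (d : SpaceDim) (c : ℂ) (u v : Fin d.dim → ℂ) :
    cross d u (c • v) = c • cross d u v := by
  cases d
  · have h (c : ℂ) (u v : Fin 2 → ℂ) : (fun _ : Fin 1 => u 0 * (c • v) 1 - u 1 * (c • v) 0) =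
        c • (fun _ : Fin 1 => u 0 * v 1 - u 1 * v 0) := by
      funext i
      simp only [Pi.smul_apply, smul_eq_mul]
      ring
    exact h c u v
  · exact map_smul (crossProduct (R := ℂ) u) c v

/-- The map `v ↦ e_j × v`, where `e_j` is the `j`-th vector of the canonical basis. With it,
`curl u = ∑ j, e_j × ∂_j u` for a smooth field `u`. -/
def basisCross (d : SpaceDim) (j : Fin d.dim) : Vec d →L[ℂ] CurlVec d :=
  LinearMap.toContinuousLinearMap
    { toFun := fun v => WithLp.toLp 2 (cross d (Pi.single j 1) v.ofLp)
      map_add' := fun v w => by rw [WithLp.ofLp_add, cross_add, WithLp.toLp_add]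
      map_smul' := fun c v => by
        rw [WithLp.ofLp_smul, cross_smul, WithLp.toLp_smul, RingHom.id_apply] }

/-! ### Test fields and weak derivatives -/

/-- `ψ ∈ C_c^∞(Ω; F)`. -/
structure IsTest {d : SpaceDim} {F : Type*} [NormedAddCommGroup F] [NormedSpace ℝ F]
    (Ω : Set (Space d)) (ψ : Space d → F) : Prop where
  smooth : ContDiff ℝ ∞ ψ
  compact : HasCompactSupport ψ
  subset : tsupport ψ ⊆ Ω

/-- The classical partial derivative `∂_j ψ`. -/
def pderiv {d : SpaceDim} {F : Type*} [NormedAddCommGroup F] [NormedSpace ℝ F]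
    (j : Fin d.dim) (ψ : Space d → F) (x : Space d) : F :=
  fderiv ℝ ψ x (EuclideanSpace.single j 1)

/-- `L²(Ω)^p`. -/
abbrev L2Vec {d : SpaceDim} (Ω : Set (Space d)) : Type := Lp (Vec d) 2 (volume.restrict Ω)

/-- `L²(Ω)` in the plane, `L²(Ω)^3` in space: the space in which `curl u` lives. -/
abbrev L2Curl {d : SpaceDim} (Ω : Set (Space d)) : Type := Lp (CurlVec d) 2 (volume.restrict Ω)

theorem IsTest.memLp {d : SpaceDim} {F : Type*} [NormedAddCommGroup F] [NormedSpace ℝ F]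
    {Ω : Set (Space d)} {ψ : Space d → F} (h : IsTest Ω ψ) :
    MemLp ψ 2 (volume.restrict Ω) :=
  (h.smooth.continuous.memLp_of_hasCompactSupport h.compact).restrict Ω

theorem IsTest.memLp_pderiv {d : SpaceDim} {F : Type*} [NormedAddCommGroup F] [NormedSpace ℝ F]
    {Ω : Set (Space d)} {ψ : Space d → F} (h : IsTest Ω ψ) (j : Fin d.dim) :
    MemLp (pderiv j ψ) 2 (volume.restrict Ω) := by
  have h1 : Continuous (pderiv j ψ) :=
    (h.smooth.continuous_fderiv (by simp)).clm_apply continuous_const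
  have h2 : HasCompactSupport (pderiv j ψ) := by
    refine (h.compact.fderiv (𝕜 := ℝ)).mono ?_
    intro x hx hx'
    exact hx (by simp [pderiv, hx'])
  exact (h1.memLp_of_hasCompactSupport h2).restrict Ω

/-- The `L²(Ω)` product `∫_Ω f · conj ψ` is the inner product of `L²(Ω)`. -/
theorem integral_inner_eq {d : SpaceDim} {F : Type*} [NormedAddCommGroup F]
    [InnerProductSpace ℂ F] {Ω : Set (Space d)} {ψ : Space d → F}
    (h : MemLp ψ 2 (volume.restrict Ω)) (f : Lp F 2 (volume.restrict Ω)) :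
    ∫ x in Ω, ⟪ψ x, f x⟫_ℂ = ⟪h.toLp ψ, f⟫_ℂ := by
  rw [L2.inner_def]
  refine integral_congr_ae ?_
  filter_upwards [h.coeFn_toLp] with x hx
  rw [hx]

/-- `w = curl u` in the weak sense in `Ω`: for every test field `ψ`,
`∫_Ω w · conj ψ = -∑ j, ∫_Ω (e_j × u) · conj (∂_j ψ)`.
The right-hand side is `∫_Ω u · conj (curl ψ)`, with `curl ψ = ∑ j, e_j × ∂_j ψ` in space and
`curl ψ = (∂₂ψ, -∂₁ψ)` (the vector curl of a scalar function) in the plane. -/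
def IsWeakCurl {d : SpaceDim} (Ω : Set (Space d)) (u : L2Vec Ω) (w : L2Curl Ω) : Prop :=
  ∀ ψ : Space d → CurlVec d, IsTest Ω ψ →
    ∫ x in Ω, ⟪ψ x, w x⟫_ℂ = -∑ j, ∫ x in Ω, ⟪pderiv j ψ x, basisCross d j (u x)⟫_ℂ

/-- `g = ∂_j φ` in the weak sense in `Ω`. -/
def IsWeakPartial {d : SpaceDim} (Ω : Set (Space d)) (j : Fin d.dim) (φ g : L2Curl Ω) : Prop :=
  ∀ ψ : Space d → CurlVec d, IsTest Ω ψ →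
    ∫ x in Ω, ⟪ψ x, g x⟫_ℂ = -∫ x in Ω, ⟪pderiv j ψ x, φ x⟫_ℂ

/-! ### `H(curl)` -/

/-- The operator `u ↦ e_j × u` from `L²(Ω)^p` to the space of the curls. -/
def basisCrossL2 {d : SpaceDim} (Ω : Set (Space d)) (j : Fin d.dim) : L2Vec Ω →L[ℂ] L2Curl Ω :=
  (basisCross d j).compLpL 2 (volume.restrict Ω)

theorem integral_basisCross {d : SpaceDim} {Ω : Set (Space d)} {ψ : Space d → CurlVec d}
    (h : MemLp ψ 2 (volume.restrict Ω)) (j : Fin d.dim) (u : L2Vec Ω) :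
    ∫ x in Ω, ⟪ψ x, basisCross d j (u x)⟫_ℂ = ⟪h.toLp ψ, basisCrossL2 Ω j u⟫_ℂ := by
  rw [← integral_inner_eq]
  refine integral_congr_ae ?_
  filter_upwards [(basisCross d j).coeFn_compLpL (p := 2) (μ := volume.restrict Ω) u] with x hx
  rw [basisCrossL2, hx]

theorem isWeakCurl_iff {d : SpaceDim} {Ω : Set (Space d)} {u : L2Vec Ω} {w : L2Curl Ω} :
    IsWeakCurl Ω u w ↔ ∀ (ψ : Space d → CurlVec d) (hψ : IsTest Ω ψ),
      ⟪hψ.memLp.toLp ψ, w⟫_ℂ =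
        -∑ j, ⟪(hψ.memLp_pderiv j).toLp (pderiv j ψ), basisCrossL2 Ω j u⟫_ℂ := by
  refine forall_congr' fun ψ => forall_congr' fun hψ => ?_
  rw [integral_inner_eq hψ.memLp]
  simp_rw [fun j => integral_basisCross (hψ.memLp_pderiv j) j u]

/-- `H(curl) = {u ∈ L²(Ω)^p | curl u ∈ L²(Ω)^q}` (`q = 1` in the plane, `q = 3` in space), each
element being recorded as the pair `(u, curl u)`; the norm is the graph norm
`‖u‖² + ‖curl u‖²`, square-rooted. -/
def hcurl {d : SpaceDim} (Ω : Set (Space d)) :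
    Submodule ℂ (WithLp 2 (L2Vec Ω × L2Curl Ω)) where
  carrier := {v | IsWeakCurl Ω v.fst v.snd}
  zero_mem' := by
    rw [Set.mem_ofPred_eq, isWeakCurl_iff]
    intro ψ hψ
    simp
  add_mem' := by
    intro v w hv hw
    rw [Set.mem_ofPred_eq, isWeakCurl_iff] at *
    intro ψ hψ
    simp only [WithLp.add_fst, WithLp.add_snd, map_add, inner_add_right, Finset.sum_add_distrib,
      hv ψ hψ, hw ψ hψ]
    ring
  smul_mem' := by
    intro c v hv
    rw [Set.mem_ofPred_eq, isWeakCurl_iff] at *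
    intro ψ hψ
    simp only [WithLp.smul_fst, WithLp.smul_snd, map_smul, inner_smul_right, hv ψ hψ,
      ← Finset.mul_sum]
    ring

/-- The Hilbert space `H(curl)`. -/
abbrev HCurl {d : SpaceDim} (Ω : Set (Space d)) : Type := ↥(hcurl Ω)

instance {d : SpaceDim} (Ω : Set (Space d)) : NormedAddCommGroup (HCurl Ω) :=
  Submodule.normedAddCommGroup _

instance {d : SpaceDim} (Ω : Set (Space d)) : InnerProductSpace ℂ (HCurl Ω) :=
  Submodule.innerProductSpace _

instance {d : SpaceDim} (Ω : Set (Space d)) : NormedSpace ℝ (HCurl Ω) :=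
  NormedSpace.complexToReal

/-- The field `u ∈ L²(Ω)^p` underlying an element of `H(curl)`. -/
def HCurl.field {d : SpaceDim} {Ω : Set (Space d)} (u : HCurl Ω) : L2Vec Ω :=
  (u : WithLp 2 (L2Vec Ω × L2Curl Ω)).fst

/-- The weak curl of an element of `H(curl)`. -/
def HCurl.curl {d : SpaceDim} {Ω : Set (Space d)} (u : HCurl Ω) : L2Curl Ω :=
  (u : WithLp 2 (L2Vec Ω × L2Curl Ω)).snd

/-! ### `H^{1/2}(Γ)` and its antidual `H^{-1/2}(Γ)` -/

/-- The Sobolev space `H¹(Ω)^q` (`q = 1` in the plane, `q = 3` in space), each element being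
recorded with its weak partial derivatives. -/
def h1 {d : SpaceDim} (Ω : Set (Space d)) :
    Submodule ℂ (WithLp 2 (L2Curl Ω × PiLp 2 (fun _ : Fin d.dim => L2Curl Ω))) where
  carrier := {v | ∀ j, IsWeakPartial Ω j v.fst (v.snd j)}
  zero_mem' := by
    intro j ψ hψ
    rw [integral_inner_eq hψ.memLp, integral_inner_eq (hψ.memLp_pderiv j)]
    simp
  add_mem' := by
    intro v w hv hw j ψ hψ
    have h1 := hv j ψ hψ
    have h2 := hw j ψ hψ
    rw [integral_inner_eq hψ.memLp, integral_inner_eq (hψ.memLp_pderiv j)] at h1 h2 ⊢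
    simp only [WithLp.add_fst, WithLp.add_snd, PiLp.add_apply, inner_add_right, h1, h2]
    ring
  smul_mem' := by
    intro c v hv j ψ hψ
    have h1 := hv j ψ hψ
    rw [integral_inner_eq hψ.memLp, integral_inner_eq (hψ.memLp_pderiv j)] at h1 ⊢
    simp only [WithLp.smul_fst, WithLp.smul_snd, PiLp.smul_apply, inner_smul_right, h1]
    ring

/-- The Hilbert space `H¹(Ω)^q`. -/
abbrev H1 {d : SpaceDim} (Ω : Set (Space d)) : Type := ↥(h1 Ω)

instance {d : SpaceDim} (Ω : Set (Space d)) : NormedAddCommGroup (H1 Ω) :=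
  Submodule.normedAddCommGroup _

instance {d : SpaceDim} (Ω : Set (Space d)) : InnerProductSpace ℂ (H1 Ω) :=
  Submodule.innerProductSpace _

/-- The `L²` class of an element of `H¹(Ω)^q`. -/
def H1.val {d : SpaceDim} {Ω : Set (Space d)} (φ : H1 Ω) : L2Curl Ω :=
  (φ : WithLp 2 (L2Curl Ω × PiLp 2 (fun _ : Fin d.dim => L2Curl Ω))).fst

/-- The weak partial derivatives of an element of `H¹(Ω)^q`. -/
def H1.partial {d : SpaceDim} {Ω : Set (Space d)} (φ : H1 Ω) (j : Fin d.dim) : L2Curl Ω :=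
  (φ : WithLp 2 (L2Curl Ω × PiLp 2 (fun _ : Fin d.dim => L2Curl Ω))).snd j

/-- The elements of `H¹(Ω)^q` that are given by a test field and its classical derivatives. -/
def testH1 {d : SpaceDim} (Ω : Set (Space d)) : Set (H1 Ω) :=
  {φ | ∃ ψ : Space d → CurlVec d, IsTest Ω ψ ∧ φ.val =ᵐ[volume.restrict Ω] ψ ∧
    ∀ j, φ.partial j =ᵐ[volume.restrict Ω] pderiv j ψ}

/-- `H¹₀(Ω)^q`, the closure of the test fields in `H¹(Ω)^q`: the kernel of the boundary
restriction `φ ↦ φ|_Γ`. -/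
def h10 {d : SpaceDim} (Ω : Set (Space d)) : Submodule ℂ (H1 Ω) :=
  (Submodule.span ℂ (testH1 Ω)).topologicalClosure

instance {d : SpaceDim} (Ω : Set (Space d)) : IsClosed (h10 Ω : Set (H1 Ω)) :=
  Submodule.isClosed_topologicalClosure _

/-- `H^{1/2}(Γ)^q`, `Γ = ∂Ω`: the space of the boundary values `φ|_Γ` of the `φ ∈ H¹(Ω)^q`, with
the norm `inf {‖φ‖_{H¹(Ω)} | φ|_Γ = f}`; two elements of `H¹(Ω)^q` have the same boundary values
when they differ by an element of `H¹₀(Ω)^q`. -/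
abbrev HHalf {d : SpaceDim} (Ω : Set (Space d)) : Type := H1 Ω ⧸ h10 Ω

/-- `H^{-1/2}(Γ)^q`, the antidual of `H^{1/2}(Γ)^q`: `⟨f, φ⟩` stands for `∫_Γ f · conj φ`. -/
abbrev HMinusHalf {d : SpaceDim} (Ω : Set (Space d)) : Type := HHalf Ω →L⋆[ℂ] ℂ

/-! ### The tangential trace and the trace space `Y(Γ)` -/

/-- The boundary term in Green's formula for the curl, for `u ∈ H(curl)` and `φ ∈ H¹(Ω)^q`:
`-∫_Ω curl u · conj φ - ∑ j, ∫_Ω (e_j × u) · conj (∂_j φ)`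
(that is, `∫_Ω (u · conj (curl φ) - curl u · conj φ)`).
For smooth `u`, `φ` and a domain to which the divergence theorem applies, it is equal to
`∫_Γ (u × n) · conj φ`. -/
def greenTerm {d : SpaceDim} {Ω : Set (Space d)} (u : HCurl Ω) : H1 Ω →L⋆[ℂ] ℂ :=
  -((innerSLFlip ℂ u.curl).comp
      ((WithLp.fstL 2 ℂ (L2Curl Ω) (PiLp 2 (fun _ : Fin d.dim => L2Curl Ω))).comp
        (h1 Ω).subtypeL))
  - ∑ j, (innerSLFlip ℂ (basisCrossL2 Ω j u.field)).comp
      (((PiLp.proj (𝕜 := ℂ) 2 (fun _ : Fin d.dim => L2Curl Ω) j).comp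
        (WithLp.sndL 2 ℂ (L2Curl Ω) (PiLp 2 (fun _ : Fin d.dim => L2Curl Ω)))).comp
          (h1 Ω).subtypeL)

theorem greenTerm_apply {d : SpaceDim} {Ω : Set (Space d)} (u : HCurl Ω) (φ : H1 Ω) :
    greenTerm u φ = -⟪φ.val, u.curl⟫_ℂ - ∑ j, ⟪φ.partial j, basisCrossL2 Ω j u.field⟫_ℂ := by
  simp [greenTerm, H1.val, H1.partial]

/-- The boundary term depends only on the boundary values of `φ`. -/
theorem h10_le_ker_greenTerm {d : SpaceDim} {Ω : Set (Space d)} (u : HCurl Ω) :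
    h10 Ω ≤ (greenTerm u).ker := by
  refine Submodule.topologicalClosure_minimal _ ?_ (greenTerm u).isClosed_ker
  rw [Submodule.span_le]
  rintro φ ⟨ψ, hψ, h0, h1⟩
  rw [SetLike.mem_coe, LinearMap.mem_ker]
  change greenTerm u φ = 0
  have e0 : φ.val = hψ.memLp.toLp ψ := Lp.ext (h0.trans hψ.memLp.coeFn_toLp.symm)
  have e1 : ∀ j, φ.partial j = (hψ.memLp_pderiv j).toLp (pderiv j ψ) := fun j =>
    Lp.ext ((h1 j).trans (hψ.memLp_pderiv j).coeFn_toLp.symm)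
  have hu : IsWeakCurl Ω u.field u.curl := u.2
  rw [greenTerm_apply, e0, isWeakCurl_iff.mp hu ψ hψ]
  simp_rw [e1]
  ring

/-- The tangential trace `u ↦ u|_Γ × n`, `H(curl) → H^{-1/2}(Γ)^q`: the extension of the map
`u ↦ u|_Γ × n` of smooth fields to `H(curl)`, given by Green's formula. -/
def gammaT {d : SpaceDim} (Ω : Set (Space d)) : HCurl Ω →ₗ[ℂ] HMinusHalf Ω where
  toFun u := (h10 Ω).liftQL (greenTerm u) (h10_le_ker_greenTerm u)
  map_add' u v := by
    ext φ
    obtain ⟨φ, rfl⟩ := Submodule.mkQ_surjective _ φ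
    change greenTerm (u + v) φ = greenTerm u φ + greenTerm v φ
    have hc : (u + v).curl = u.curl + v.curl := rfl
    have hf : (u + v).field = u.field + v.field := rfl
    simp only [greenTerm_apply, hc, hf, map_add, inner_add_right, Finset.sum_add_distrib]
    ring
  map_smul' c u := by
    ext φ
    obtain ⟨φ, rfl⟩ := Submodule.mkQ_surjective _ φ
    change greenTerm (c • u) φ = c • greenTerm u φ
    have hc : (c • u).curl = c • u.curl := rfl
    have hf : (c • u).field = c • u.field := rfl
    simp only [greenTerm_apply, hc, hf, map_smul, inner_smul_right, ← Finset.mul_sum, smul_eq_mul]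
    ring

/-- `Y(Γ) = {f ∈ H^{-1/2}(Γ)^q | ∃ u ∈ H(curl), γ_t(u) = f}`. -/
def TraceSpace {d : SpaceDim} (Ω : Set (Space d)) : Type := ↥(LinearMap.range (gammaT Ω))

instance {d : SpaceDim} (Ω : Set (Space d)) : AddCommGroup (TraceSpace Ω) :=
  inferInstanceAs (AddCommGroup ↥(LinearMap.range (gammaT Ω)))

instance {d : SpaceDim} (Ω : Set (Space d)) : Module ℂ (TraceSpace Ω) :=
  inferInstanceAs (Module ℂ ↥(LinearMap.range (gammaT Ω)))

instance {d : SpaceDim} (Ω : Set (Space d)) :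
    IsClosed (LinearMap.ker (gammaT Ω) : Set (HCurl Ω)) := by
  have h : (LinearMap.ker (gammaT Ω) : Set (HCurl Ω)) =
      ⋂ φ : H1 Ω, {u | -⟪φ.val, u.curl⟫_ℂ
        - ∑ j, ⟪φ.partial j, basisCrossL2 Ω j u.field⟫_ℂ = 0} := by
    ext u
    simp only [SetLike.mem_coe, LinearMap.mem_ker, Set.mem_iInter, Set.mem_ofPred_eq,
      ← greenTerm_apply]
    constructor
    · intro hu φ
      exact DFunLike.congr_fun hu (Submodule.Quotient.mk φ)
    · intro hu
      ext φ
      obtain ⟨φ, rfl⟩ := Submodule.mkQ_surjective _ φ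
      exact hu φ
  rw [h]
  refine isClosed_iInter fun φ => isClosed_eq ?_ continuous_const
  have hc : Continuous fun u : HCurl Ω => u.curl :=
    (WithLp.sndL 2 ℂ (L2Vec Ω) (L2Curl Ω)).continuous.comp continuous_subtype_val
  have hf : Continuous fun u : HCurl Ω => u.field :=
    (WithLp.fstL 2 ℂ (L2Vec Ω) (L2Curl Ω)).continuous.comp continuous_subtype_val
  fun_prop

/-- `Y(Γ)` as the quotient of `H(curl)` by the kernel of the tangential trace. -/
def TraceSpace.equivQuotient {d : SpaceDim} (Ω : Set (Space d)) :
    TraceSpace Ω ≃ₗ[ℂ] (HCurl Ω ⧸ LinearMap.ker (gammaT Ω)) :=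
  (LinearMap.quotKerEquivRange (gammaT Ω)).symm

/-- The norm of `Y(Γ)`: `‖f‖ = inf {‖u‖_{H(curl)} | u ∈ H(curl), γ_t(u) = f}`. -/
instance {d : SpaceDim} (Ω : Set (Space d)) : NormedAddCommGroup (TraceSpace Ω) :=
  NormedAddCommGroup.induced (TraceSpace Ω) (HCurl Ω ⧸ LinearMap.ker (gammaT Ω))
    (TraceSpace.equivQuotient Ω) (TraceSpace.equivQuotient Ω).injective

instance {d : SpaceDim} (Ω : Set (Space d)) : NormedSpace ℂ (TraceSpace Ω) :=
  NormedSpace.induced ℂ (TraceSpace Ω) (HCurl Ω ⧸ LinearMap.ker (gammaT Ω))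
    (TraceSpace.equivQuotient Ω)

/-- The tangential trace `γ_t : H(curl) → Y(Γ)`. -/
def tangentialTrace {d : SpaceDim} (Ω : Set (Space d)) : HCurl Ω →ₗ[ℂ] TraceSpace Ω :=
  LinearMap.rangeRestrict (gammaT Ω)

/-! ### Refractive indices -/

/-- The complex refractive index `κ(x) = (ε(x) + i σ(x) / ω) / ε₀`, where `ω = freq`
is the frequency. -/
def refractiveIndex {d : SpaceDim} (freq ε₀ : ℝ) (ε σ : Space d → ℝ) (x : Space d) : ℂ :=
  (1 / (ε₀ : ℂ)) * ((ε x : ℂ) + Complex.I * ((σ x : ℂ) / (freq : ℂ)))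

/-- The permittivity `ε` and the conductivity `σ` are admissible: they belong to `L^∞(Ω)` and are
bounded from below by positive constants almost everywhere in `Ω`. -/
structure AdmissiblePair {d : SpaceDim} (Ω : Set (Space d)) (ε σ : Space d → ℝ) : Prop where
  memLp_eps : MemLp ε ⊤ (volume.restrict Ω)
  memLp_sigma : MemLp σ ⊤ (volume.restrict Ω)
  eps_lower : ∃ c : ℝ, 0 < c ∧ ∀ᵐ x ∂(volume.restrict Ω), c ≤ ε x
  sigma_lower : ∃ c : ℝ, 0 < c ∧ ∀ᵐ x ∂(volume.restrict Ω), c ≤ σ x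

/-- `κ` is an admissible refractive index in `Ω`. -/
def AdmissibleIndex {d : SpaceDim} (Ω : Set (Space d)) (freq ε₀ : ℝ) (κ : Space d → ℂ) : Prop :=
  ∃ ε σ : Space d → ℝ, AdmissiblePair Ω ε σ ∧ ∀ x ∈ Ω, κ x = refractiveIndex freq ε₀ ε σ x

/-- The perturbed refractive index `κ_a = κ₀ (1 + a χ_D)`. -/
def perturbedIndex {d : SpaceDim} (κ₀ : Space d → ℂ) (D : Set (Space d)) (a : ℝ)
    (x : Space d) : ℂ :=
  κ₀ x * (1 + (a : ℂ) * D.indicator (fun _ => (1 : ℂ)) x)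

/-- The wave number `k = ω √(μ₀ ε₀)`, where `ω = freq` is the frequency. -/
def waveNumber (freq μ₀ ε₀ : ℝ) : ℝ := freq * Real.sqrt (μ₀ * ε₀)

/-! ### The direct problem -/

/-- `E ∈ H(curl)` is the weak solution of `curl curl E - k² κ E = 0` in `Ω`,
`curl E × n = g` on `Γ`: for all `φ ∈ H(curl)`,
`(curl E, curl φ) - k² (κ E, φ) = ⟨g, φ_T⟩_Γ`.
Here `(·,·)` is the (sesquilinear) `L²(Ω)` product and `⟨g, φ_T⟩_Γ` the bracket between the
antidual `Y(Γ)'` and `Y(Γ)`; the tangential component `φ_T = n × (φ × n)` is represented in `Y(Γ)`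
by `γ_t(φ) = φ × n`, to which it corresponds by a rotation by a right angle in the tangent plane. -/
def IsDirectSolution {d : SpaceDim} (Ω : Set (Space d)) (k : ℝ) (κ : Space d → ℂ)
    (g : TraceSpace Ω →L⋆[ℂ] ℂ) (E : HCurl Ω) : Prop :=
  ∀ φ : HCurl Ω,
    ⟪φ.curl, E.curl⟫_ℂ - (k : ℂ) ^ 2 * ∫ x in Ω, κ x * ⟪φ.field x, E.field x⟫_ℂ =
      g (tangentialTrace Ω φ)

open Classical in
/-- The solution `E[κ]` of the direct problem (`0` if there is not exactly one solution). -/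
def directSolution {d : SpaceDim} (Ω : Set (Space d)) (k : ℝ) (g : TraceSpace Ω →L⋆[ℂ] ℂ)
    (κ : Space d → ℂ) : HCurl Ω :=
  if h : ∃! E : HCurl Ω, IsDirectSolution Ω k κ g E then h.choose else 0

/-- The map `K : a ↦ E[κ_a]`. -/
def fieldMap {d : SpaceDim} (Ω : Set (Space d)) (k : ℝ) (g : TraceSpace Ω →L⋆[ℂ] ℂ)
    (κ₀ : Space d → ℂ) (D : Set (Space d)) (a : ℝ) : HCurl Ω :=
  directSolution Ω k g (perturbedIndex κ₀ D a)

/-- The map `K_t : a ↦ γ_t(E[κ_a])`. -/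
def traceMap {d : SpaceDim} (Ω : Set (Space d)) (k : ℝ) (g : TraceSpace Ω →L⋆[ℂ] ℂ)
    (κ₀ : Space d → ℂ) (D : Set (Space d)) (a : ℝ) : TraceSpace Ω :=
  tangentialTrace Ω (directSolution Ω k g (perturbedIndex κ₀ D a))

end Maxwell

end

open MeasureTheory ContinuousLinearMap
open scoped ContDiff InnerProductSpace NNReal ENNReal InnerProduct

noncomputable section

namespace Maxwell

variable {d : SpaceDim} {Ω : Set (Space d)}

/-! ### `H(curl)` is a Hilbert space -/

/-! By Riesz representation in the Hilbert space `H(curl)`, the weak formulation is an operator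
equation `A_a E = r`, where `A_a` represents the form `(curl E, curl φ) - k² (κ_a E, φ)` and `r` the
Neumann datum. Three facts give the theorem.

Coercivity (`isUnit_maxwellOp`): the conductivity bounds `Im κ_a` below by a positive constant. The
imaginary part of the form therefore controls `‖u‖²`, and the real part controls `‖curl u‖²` up to a
multiple of `‖u‖²`. A weighted sum bounds the modulus of the form below by a multiple of the squared
graph norm, so `A_a` is invertible; no compactness argument enters.

Affine dependence (`exists_perturbedIndex_ae_eq`, `maxwellOp_add_smul`): `κ_a` is affine in `a` with
coefficients in `L^∞(Ω)`, hence `A_a = P + a Q` with bounded `P` and `Q`. Inversion is smooth on the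
units of a Banach algebra, so `E[κ_a] = A_a⁻¹ r` is smooth in `a`.

Bounded trace (`norm_tangentialTrace_le`): `γ_t` is linear and bounded from `H(curl)` to `Y(Γ)`, so
it preserves smoothness and commutes with derivatives of every order. -/

theorem isClosed_hcurl : IsClosed (hcurl Ω : Set (WithLp 2 (L2Vec Ω × L2Curl Ω))) := by
  have h : (hcurl Ω : Set (WithLp 2 (L2Vec Ω × L2Curl Ω))) =
      ⋂ (ψ : Space d → CurlVec d) (hψ : IsTest Ω ψ), {v | ⟪hψ.memLp.toLp ψ, v.snd⟫_ℂ =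
        -∑ j, ⟪(hψ.memLp_pderiv j).toLp (pderiv j ψ), basisCrossL2 Ω j v.fst⟫_ℂ} := by
    ext v
    simp only [Set.mem_iInter, Set.mem_ofPred_eq]
    exact isWeakCurl_iff
  have hc : Continuous fun v : WithLp 2 (L2Vec Ω × L2Curl Ω) => v.snd :=
    (WithLp.sndL 2 ℂ (L2Vec Ω) (L2Curl Ω)).continuous
  have hf : Continuous fun v : WithLp 2 (L2Vec Ω × L2Curl Ω) => v.fst :=
    (WithLp.fstL 2 ℂ (L2Vec Ω) (L2Curl Ω)).continuous
  rw [h]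
  refine isClosed_iInter fun ψ => isClosed_iInter fun hψ => isClosed_eq ?_ ?_ <;> fun_prop

/-- Completeness is what gives access to adjoints, to Riesz representation and to invertibility from
a lower bound on the form. -/
instance : CompleteSpace (HCurl Ω) :=
  isClosed_hcurl.completeSpace_coe

/-- The bounded operator `u ↦ u`, `H(curl) → L²(Ω)^p`. -/
def HCurl.fieldL (Ω : Set (Space d)) : HCurl Ω →L[ℂ] L2Vec Ω :=
  (WithLp.fstL 2 ℂ (L2Vec Ω) (L2Curl Ω)).comp (hcurl Ω).subtypeL

/-- The bounded operator `u ↦ curl u` on `H(curl)`. -/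
def HCurl.curlL (Ω : Set (Space d)) : HCurl Ω →L[ℂ] L2Curl Ω :=
  (WithLp.sndL 2 ℂ (L2Vec Ω) (L2Curl Ω)).comp (hcurl Ω).subtypeL

theorem HCurl.norm_sq_eq (u : HCurl Ω) : ‖u‖ ^ 2 = ‖u.field‖ ^ 2 + ‖u.curl‖ ^ 2 :=
  WithLp.prod_norm_sq_eq_of_L2 (u : WithLp 2 (L2Vec Ω × L2Curl Ω))

/-! ### The tangential trace is bounded -/

/-- The norm of `Y(Γ)` is transported from the quotient of `H(curl)` by the kernel of the trace.
Under this identification the trace is the quotient map, which is a contraction. -/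
theorem norm_tangentialTrace_le (u : HCurl Ω) : ‖tangentialTrace Ω u‖ ≤ ‖u‖ := by
  have h : TraceSpace.equivQuotient Ω (tangentialTrace Ω u) = Submodule.Quotient.mk u :=
    (LinearEquiv.symm_apply_eq _).2 rfl
  change ‖TraceSpace.equivQuotient Ω (tangentialTrace Ω u)‖ ≤ ‖u‖
  rw [h]
  exact Submodule.Quotient.norm_mk_le _ u

/-- The tangential trace as a bounded operator `H(curl) → Y(Γ)`. -/
def tangentialTraceL (Ω : Set (Space d)) : HCurl Ω →L[ℂ] TraceSpace Ω :=
  (tangentialTrace Ω).mkContinuous 1 fun u => by simpa using norm_tangentialTrace_le u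

/-! ### Multiplication by bounded functions -/

/-- Multiplication of fields in `L²(Ω)^p` by a function in `L^∞(Ω)`. -/
def mulL (Ω : Set (Space d)) :
    Lp ℂ ∞ (volume.restrict Ω) →L[ℂ] L2Vec Ω →L[ℂ] L2Vec Ω :=
  (ContinuousLinearMap.lsmul ℂ ℂ).holderL (volume.restrict Ω) ∞ 2 2

theorem coeFn_mulL (m : Lp ℂ ∞ (volume.restrict Ω)) (u : L2Vec Ω) :
    mulL Ω m u =ᵐ[volume.restrict Ω] fun x => m x • u x :=
  (ContinuousLinearMap.lsmul ℂ ℂ).coeFn_holder m u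

theorem inner_mulL (m : Lp ℂ ∞ (volume.restrict Ω)) (u v : L2Vec Ω) :
    ⟪v, mulL Ω m u⟫_ℂ = ∫ x in Ω, m x * ⟪v x, u x⟫_ℂ := by
  rw [L2.inner_def]
  refine integral_congr_ae ?_
  filter_upwards [coeFn_mulL m u] with x hx
  rw [hx, inner_smul_right]

/-- Pointwise the integrand is `m x * ‖u x‖ ^ 2`, and the second factor is real, so only the
imaginary part of `m` contributes. -/
theorem le_im_inner_mulL {m : Lp ℂ ∞ (volume.restrict Ω)} {s : ℝ}
    (hs : ∀ᵐ x ∂(volume.restrict Ω), s ≤ (m x).im) (u : L2Vec Ω) :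
    s * ‖u‖ ^ 2 ≤ (⟪u, mulL Ω m u⟫_ℂ).im := by
  have h2 : ‖u‖ ^ 2 = ∫ x in Ω, ‖u x‖ ^ 2 := by
    rw [← inner_self_eq_norm_sq (𝕜 := ℂ), L2.inner_def,
      ← integral_re (L2.integrable_inner (𝕜 := ℂ) u u)]
    simp only [inner_self_eq_norm_sq (𝕜 := ℂ)]
  have h3 : (⟪u, mulL Ω m u⟫_ℂ).im = ∫ x in Ω, (⟪u x, mulL Ω m u x⟫_ℂ).im := by
    rw [L2.inner_def]
    exact (integral_im (L2.integrable_inner (𝕜 := ℂ) u (mulL Ω m u))).symm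
  rw [h2, h3, ← integral_const_mul]
  refine integral_mono_ae ?_ (L2.integrable_inner (𝕜 := ℂ) u (mulL Ω m u)).im ?_
  · exact ((Lp.memLp u).integrable_norm_pow (by norm_num)).const_mul s
  · filter_upwards [hs, coeFn_mulL m u] with x hx hm
    rw [hm, inner_smul_right, inner_self_eq_norm_sq_to_K]
    have : ((m x) * ((‖u x‖ : ℂ)) ^ 2).im = (m x).im * ‖u x‖ ^ 2 := by
      rw [← Complex.ofReal_pow, Complex.im_mul_ofReal]
    exact (mul_le_mul_of_nonneg_right hx (by positivity)).trans_eq this.symm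

/-! ### The Maxwell operator -/

/-- The operator on `H(curl)` representing the sesquilinear form
`(E, φ) ↦ (curl E, curl φ) - k² (m E, φ)`. -/
def maxwellOp (Ω : Set (Space d)) (k : ℝ) (m : Lp ℂ ∞ (volume.restrict Ω)) :
    HCurl Ω →L[ℂ] HCurl Ω :=
  ((HCurl.curlL Ω)† ∘L HCurl.curlL Ω) -
    ((k : ℂ) ^ 2) • ((HCurl.fieldL Ω)† ∘L mulL Ω m ∘L HCurl.fieldL Ω)

theorem inner_maxwellOp (k : ℝ) (m : Lp ℂ ∞ (volume.restrict Ω)) (φ E : HCurl Ω) :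
    ⟪φ, maxwellOp Ω k m E⟫_ℂ =
      ⟪φ.curl, E.curl⟫_ℂ - (k : ℂ) ^ 2 * ⟪φ.field, mulL Ω m E.field⟫_ℂ := by
  have h : maxwellOp Ω k m E = adjoint (HCurl.curlL Ω) (HCurl.curlL Ω E) -
      ((k : ℂ) ^ 2) • adjoint (HCurl.fieldL Ω) (mulL Ω m (HCurl.fieldL Ω E)) := rfl
  rw [h, inner_sub_right, inner_smul_right, adjoint_inner_right, adjoint_inner_right]
  rfl

/-- The operator is affine, not linear, in the coefficient: subtracting `maxwellOp Ω k 0` removes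
the curl part and leaves the linear part at `n`. -/
theorem maxwellOp_add_smul (k : ℝ) (m n : Lp ℂ ∞ (volume.restrict Ω)) (z : ℂ) :
    maxwellOp Ω k (m + z • n) =
      maxwellOp Ω k m + z • (maxwellOp Ω k n - maxwellOp Ω k 0) := by
  refine ContinuousLinearMap.ext fun E => ext_inner_left ℂ fun φ => ?_
  simp only [inner_add_right, inner_smul_right, inner_sub_right, inner_maxwellOp, map_add,
    map_smul, map_zero, add_apply, smul_apply,
    sub_apply, zero_apply, inner_zero_right]
  ring

/-- A Lax–Milgram argument: absorption makes the form coercive in modulus, although its real part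
alone may be indefinite. -/
theorem isUnit_maxwellOp {k : ℝ} (hk : k ≠ 0) {m : Lp ℂ ∞ (volume.restrict Ω)} {s : ℝ}
    (hs0 : 0 < s) (hs : ∀ᵐ x ∂(volume.restrict Ω), s ≤ (m x).im) :
    IsUnit (maxwellOp Ω k m) := by
  have hk2 : 0 < k ^ 2 := by positivity
  set C : ℝ := ‖mulL Ω m‖
  have hC : 0 ≤ C := norm_nonneg _
  -- The constant comes from adding the real-part bound with weight `k ^ 2 * s` to the
  -- imaginary-part bound with weight `k ^ 2 * C + 1`. The `C` terms cancel, leaving `k ^ 2 * s *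
  -- ‖u‖ ^ 2`; the denominator is the sum of the weights.
  set c : ℝ := k ^ 2 * s / (k ^ 2 * s + k ^ 2 * C + 1)
  have hc : 0 < c := by positivity
  refine isUnit_of_forall_le_norm_inner_map _ (c := ⟨c, hc.le⟩) hc fun u => ?_
  change ‖u‖ ^ 2 * c ≤ _
  rw [norm_inner_symm, inner_maxwellOp, HCurl.norm_sq_eq]
  set z : ℂ := ⟪u.field, mulL Ω m u.field⟫_ℂ with hz
  have him : s * ‖u.field‖ ^ 2 ≤ z.im := le_im_inner_mulL hs u.field
  have hre : z.re ≤ C * ‖u.field‖ ^ 2 := by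
    refine (Complex.re_le_norm z).trans ((norm_inner_le_norm _ _).trans ?_)
    have := (mulL Ω m).le_opNorm u.field
    calc ‖u.field‖ * ‖mulL Ω m u.field‖ ≤ ‖u.field‖ * (C * ‖u.field‖) := by gcongr
      _ = C * ‖u.field‖ ^ 2 := by ring
  set w : ℂ := ⟪u.curl, u.curl⟫_ℂ - (k : ℂ) ^ 2 * z with hw
  have hcurl : ⟪u.curl, u.curl⟫_ℂ = ((‖u.curl‖ ^ 2 : ℝ) : ℂ) := by
    rw [Complex.ofReal_pow]
    exact inner_self_eq_norm_sq_to_K u.curl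
  rw [hcurl] at hw
  have hwre : w.re = ‖u.curl‖ ^ 2 - k ^ 2 * z.re := by
    rw [hw, ← Complex.ofReal_pow k, Complex.sub_re, Complex.re_ofReal_mul, Complex.ofReal_re]
  have hwim : w.im = - (k ^ 2 * z.im) := by
    rw [hw, ← Complex.ofReal_pow k, Complex.sub_im, Complex.im_ofReal_mul, Complex.ofReal_im,
      zero_sub]
  have h1 : ‖u.curl‖ ^ 2 - k ^ 2 * (C * ‖u.field‖ ^ 2) ≤ ‖w‖ := by
    refine le_trans ?_ (Complex.re_le_norm w)
    rw [hwre]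
    gcongr
  have h2 : k ^ 2 * (s * ‖u.field‖ ^ 2) ≤ ‖w‖ := by
    refine le_trans ?_ ((neg_le_abs _).trans (Complex.abs_im_le_norm w))
    rw [hwim, neg_neg]
    gcongr
  have hpos : 0 < k ^ 2 * s + k ^ 2 * C + 1 := by positivity
  rw [mul_div_assoc', div_le_iff₀ hpos]
  have h3 := mul_le_mul_of_nonneg_left h1 (by positivity : 0 ≤ k ^ 2 * s)
  have h4 := mul_le_mul_of_nonneg_left h2 (by positivity : 0 ≤ k ^ 2 * C + 1)
  linarith

/-! ### Admissible refractive indices -/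

theorem refractiveIndex_im {freq ε₀ : ℝ} (ε σ : Space d → ℝ) (x : Space d) :
    (refractiveIndex freq ε₀ ε σ x).im = σ x / (ε₀ * freq) := by
  have h : refractiveIndex freq ε₀ ε σ x =
      ((ε x / ε₀ : ℝ) : ℂ) + ((σ x / (ε₀ * freq) : ℝ) : ℂ) * Complex.I := by
    rw [refractiveIndex]
    push_cast
    rw [div_eq_mul_inv, div_eq_mul_inv, div_eq_mul_inv, div_eq_mul_inv, mul_inv]
    ring
  rw [h, Complex.add_im, Complex.ofReal_im, Complex.im_ofReal_mul, Complex.I_im, mul_one,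
    zero_add]

theorem AdmissibleIndex.memLp {freq ε₀ : ℝ} {κ : Space d → ℂ} (hΩ : MeasurableSet Ω)
    (h : AdmissibleIndex Ω freq ε₀ κ) : MemLp κ ∞ (volume.restrict Ω) := by
  obtain ⟨ε, σ, hp, hκ⟩ := h
  have h1 : MemLp (refractiveIndex freq ε₀ ε σ) ∞ (volume.restrict Ω) := by
    have hσ := ((hp.memLp_sigma.ofReal (K := ℂ)).const_mul ((freq : ℂ)⁻¹)).const_mul Complex.I
    refine (((hp.memLp_eps.ofReal (K := ℂ)).add hσ).const_mul (1 / (ε₀ : ℂ))).ae_eq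
      (.of_forall fun x => ?_)
    simp [refractiveIndex, div_eq_inv_mul]
  refine h1.ae_eq ?_
  filter_upwards [ae_restrict_mem hΩ] with x hx
  exact (hκ x hx).symm

theorem AdmissibleIndex.exists_le_im {freq ε₀ : ℝ} {κ : Space d → ℂ} (hΩ : MeasurableSet Ω)
    (hfreq : 0 < freq) (hε₀ : 0 < ε₀) (h : AdmissibleIndex Ω freq ε₀ κ) :
    ∃ s : ℝ, 0 < s ∧ ∀ᵐ x ∂(volume.restrict Ω), s ≤ (κ x).im := by
  obtain ⟨ε, σ, hp, hκ⟩ := h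
  obtain ⟨c, hc, hσ⟩ := hp.sigma_lower
  refine ⟨c / (ε₀ * freq), by positivity, ?_⟩
  filter_upwards [hσ, ae_restrict_mem hΩ] with x hx hxΩ
  rw [hκ x hxΩ, refractiveIndex_im]
  gcongr

/-- If `κ₀ (1 + a χ_D)` is bounded for two values of `a`, then it is an affine function of `a`
with values in `L^∞(Ω)`. -/
theorem exists_perturbedIndex_ae_eq {κ₀ : Space d → ℂ} {D : Set (Space d)} {a b : ℝ}
    (hab : a ≠ b) (ha : MemLp (perturbedIndex κ₀ D a) ∞ (volume.restrict Ω))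
    (hb : MemLp (perturbedIndex κ₀ D b) ∞ (volume.restrict Ω)) :
    ∃ m n : Lp ℂ ∞ (volume.restrict Ω), ∀ c : ℝ,
      (m + (c : ℂ) • n : Lp ℂ ∞ (volume.restrict Ω)) =ᵐ[volume.restrict Ω]
        perturbedIndex κ₀ D c := by
  -- The difference quotient recovers `κ₀ χ_D`, and extrapolation to the parameter `0` recovers
  -- `κ₀`. Both are thus bounded even if `0` is not an admissible parameter.
  set n : Lp ℂ ∞ (volume.restrict Ω) := ((b - a : ℝ) : ℂ)⁻¹ • (hb.toLp _ - ha.toLp _) with hn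
  refine ⟨ha.toLp _ - (a : ℂ) • n, n, fun c => ?_⟩
  have hne : (b : ℂ) - a ≠ 0 := sub_ne_zero.2 (by exact_mod_cast hab.symm)
  filter_upwards [Lp.coeFn_add (ha.toLp _ - (a : ℂ) • n) ((c : ℂ) • n),
    Lp.coeFn_sub (ha.toLp _) ((a : ℂ) • n), Lp.coeFn_smul (a : ℂ) n, Lp.coeFn_smul (c : ℂ) n,
    Lp.coeFn_smul (((b - a : ℝ) : ℂ)⁻¹) (hb.toLp _ - ha.toLp _),
    Lp.coeFn_sub (hb.toLp _) (ha.toLp _), ha.coeFn_toLp, hb.coeFn_toLp]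
    with x h1 h2 h3 h4 h5 h6 h7 h8
  rw [← hn] at h5
  simp only [Pi.add_apply, Pi.sub_apply, Pi.smul_apply, smul_eq_mul] at h1 h2 h3 h4 h5 h6
  rw [h1, h2, h3, h4, h5, h6, h7, h8]
  simp only [perturbedIndex]
  push_cast
  field_simp
  ring

/-! ### The direct problem -/

/-- The Riesz representative in `H(curl)` of the Neumann datum `g`. -/
def datumRep (g : TraceSpace Ω →L⋆[ℂ] ℂ) : HCurl Ω :=
  (InnerProductSpace.toDual ℂ (HCurl Ω)).symm
    -- The datum is antilinear, so its conjugate is the linear functional to which Riesz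
    -- representation applies.
    ((starL ℂ : ℂ ≃L⋆[ℂ] ℂ).toContinuousLinearMap.comp (g.comp (tangentialTraceL Ω)))

theorem inner_datumRep (g : TraceSpace Ω →L⋆[ℂ] ℂ) (φ : HCurl Ω) :
    ⟪φ, datumRep g⟫_ℂ = g (tangentialTrace Ω φ) := by
  rw [← inner_conj_symm, datumRep, InnerProductSpace.toDual_symm_apply]
  exact star_star _

theorem isDirectSolution_iff {k : ℝ} {κ : Space d → ℂ} {m : Lp ℂ ∞ (volume.restrict Ω)}
    (hm : m =ᵐ[volume.restrict Ω] κ) (g : TraceSpace Ω →L⋆[ℂ] ℂ) (E : HCurl Ω) :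
    IsDirectSolution Ω k κ g E ↔ maxwellOp Ω k m E = datumRep g := by
  have h (φ : HCurl Ω) : ∫ x in Ω, κ x * ⟪φ.field x, E.field x⟫_ℂ =
      ⟪φ.field, mulL Ω m E.field⟫_ℂ := by
    rw [inner_mulL]
    refine integral_congr_ae ?_
    filter_upwards [hm] with x hx
    rw [hx]
  constructor
  · intro hE
    refine ext_inner_left ℂ fun φ => ?_
    rw [inner_maxwellOp, inner_datumRep, ← hE φ, h]
  · intro hE φ
    rw [h, ← inner_maxwellOp, hE, inner_datumRep]

theorem isDirectSolution_iff_eq_inverse {k : ℝ} {κ : Space d → ℂ}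
    {m : Lp ℂ ∞ (volume.restrict Ω)} (hm : m =ᵐ[volume.restrict Ω] κ)
    (hu : IsUnit (maxwellOp Ω k m)) (g : TraceSpace Ω →L⋆[ℂ] ℂ) (E : HCurl Ω) :
    IsDirectSolution Ω k κ g E ↔ E = Ring.inverse (maxwellOp Ω k m) (datumRep g) := by
  rw [isDirectSolution_iff hm]
  constructor
  · rintro h
    rw [← h, ← mul_apply_eq_comp, Ring.inverse_mul_cancel _ hu]
    rfl
  · rintro rfl
    rw [← mul_apply_eq_comp, Ring.mul_inverse_cancel _ hu]
    rfl

/-- Unique solvability rules out the default value `0` of `directSolution`. -/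
theorem directSolution_eq {k : ℝ} {κ : Space d → ℂ} {g : TraceSpace Ω →L⋆[ℂ] ℂ} {E : HCurl Ω}
    (h : ∀ E', IsDirectSolution Ω k κ g E' ↔ E' = E) : directSolution Ω k g κ = E := by
  have hex : ∃! E, IsDirectSolution Ω k κ g E := ⟨E, (h E).2 rfl, fun E' => (h E').1⟩
  rw [directSolution, dif_pos hex]
  exact (h _).1 hex.choose_spec.1

end Maxwell

/-- Inversion is smooth at a unit, and the units form an open set, so the value `0` of
`Ring.inverse` off the units plays no role near `a`. Smoothness is proved in a complex parameter and
then restricted to the real line. -/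
theorem ContinuousLinearMap.contDiffAt_inverse_add_smul_apply {H : Type*} [NormedAddCommGroup H]
    [NormedSpace ℂ H] [CompleteSpace H] {P Q : H →L[ℂ] H} (v : H) {a : ℝ}
    (hu : IsUnit (P + (a : ℂ) • Q)) :
    ContDiffAt ℝ ∞ (fun t : ℝ => Ring.inverse (P + (t : ℂ) • Q) v) a := by
  obtain ⟨U, hU⟩ := hu
  have hinv : ContDiffAt ℂ ∞ Ring.inverse ((fun z : ℂ => P + z • Q) a) := by
    change ContDiffAt ℂ ∞ Ring.inverse (P + (a : ℂ) • Q)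
    rw [← hU]
    exact contDiffAt_ringInverse ℂ U
  have haff : ContDiffAt ℂ ∞ (fun z : ℂ => P + z • Q) a := by fun_prop
  have hev : ContDiff ℂ ∞ fun B : H →L[ℂ] H => B v := (ContinuousLinearMap.apply ℂ H v).contDiff
  have h : ContDiffAt ℂ ∞ (fun z : ℂ => Ring.inverse (P + z • Q) v) a :=
    ContDiffAt.comp (a : ℂ) hev.contDiffAt
      (ContDiffAt.comp (f := fun z : ℂ => P + z • Q) (a : ℂ) hinv haff)
  exact (h.restrict_scalars ℝ).comp a Complex.ofRealCLM.contDiff.contDiffAt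

theorem ContinuousLinearMap.iteratedDeriv_comp_left {E F : Type*} [NormedAddCommGroup E]
    [NormedSpace ℝ E] [NormedAddCommGroup F] [NormedSpace ℝ F] (T : E →L[ℝ] F) {f : ℝ → E}
    {a : ℝ} {n : ℕ} (hf : ContDiffAt ℝ n f a) :
    iteratedDeriv n (fun x => T (f x)) a = T (iteratedDeriv n f a) := by
  rw [iteratedDeriv, iteratedDeriv]
  -- The iterated derivative is the iterated Fréchet derivative evaluated at the vectors `1`.
  exact congrArg (fun M => M fun _ => 1) (T.iteratedFDeriv_comp_left hf le_rfl)

theorem mainTheorem4 (d : Maxwell.SpaceDim) (Ω : Set (Maxwell.Space d))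
    (hΩ_open : IsOpen Ω) (hΩ_bdd : Bornology.IsBounded Ω) (hΩ_sc : SimplyConnectedSpace Ω)
    (freq μ₀ ε₀ : ℝ) (hfreq : 0 < freq) (hμ₀ : 0 < μ₀) (hε₀ : 0 < ε₀)
    (g : Maxwell.TraceSpace Ω →L⋆[ℂ] ℂ)
    (κ₀ : Maxwell.Space d → ℂ) (D : Set (Maxwell.Space d)) (hD : MeasurableSet D)
    (I : Set ℝ) (hI_open : IsOpen I) (hI_interval : I.OrdConnected)
    (hI : ∀ a ∈ I, Maxwell.AdmissibleIndex Ω freq ε₀ (Maxwell.perturbedIndex κ₀ D a)) :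
    (∀ a ∈ I, ∃! E : Maxwell.HCurl Ω, Maxwell.IsDirectSolution Ω (Maxwell.waveNumber freq μ₀ ε₀)
      (Maxwell.perturbedIndex κ₀ D a) g E) ∧
    ContDiffOn ℝ ∞ (Maxwell.fieldMap Ω (Maxwell.waveNumber freq μ₀ ε₀) g κ₀ D) I ∧
    ContDiffOn ℝ ∞ (Maxwell.traceMap Ω (Maxwell.waveNumber freq μ₀ ε₀) g κ₀ D) I ∧
    ∀ a ∈ I, ∀ n : ℕ,
      iteratedDeriv n (Maxwell.traceMap Ω (Maxwell.waveNumber freq μ₀ ε₀) g κ₀ D) a =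
        Maxwell.tangentialTrace Ω
          (iteratedDeriv n (Maxwell.fieldMap Ω (Maxwell.waveNumber freq μ₀ ε₀) g κ₀ D) a) := by
  open Maxwell in
  rcases I.eq_empty_or_nonempty with rfl | ⟨a₀, ha₀⟩
  · simp
  have hΩ : MeasurableSet Ω := hΩ_open.measurableSet
  set k := waveNumber freq μ₀ ε₀
  have hk : k ≠ 0 := (mul_pos hfreq (Real.sqrt_pos.2 (mul_pos hμ₀ hε₀))).ne'
  -- Two distinct parameters determine the affine family; openness of `I` supplies the second.
  obtain ⟨b₀, hb₀, hne⟩ : ∃ b ∈ I, a₀ ≠ b := by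
    obtain ⟨b, hb, hbI⟩ := ((eventually_nhdsWithin_of_forall (s := Set.Ioi a₀) fun _ h => h).and
      (nhdsWithin_le_nhds (hI_open.mem_nhds ha₀))).exists
    exact ⟨b, hbI, ne_of_lt hb⟩
  obtain ⟨m, n, hmn⟩ := exists_perturbedIndex_ae_eq hne ((hI a₀ ha₀).memLp hΩ)
    ((hI b₀ hb₀).memLp hΩ)
  have hunit : ∀ a ∈ I, IsUnit (maxwellOp Ω k (m + (a : ℂ) • n)) := by
    intro a ha
    obtain ⟨s, hs0, hs⟩ := (hI a ha).exists_le_im hΩ hfreq hε₀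
    refine isUnit_maxwellOp hk hs0 ?_
    filter_upwards [hs, hmn a] with x hx hx'
    rwa [hx']
  have hsol : ∀ a ∈ I, ∀ E, IsDirectSolution Ω k (perturbedIndex κ₀ D a) g E ↔
      E = Ring.inverse (maxwellOp Ω k (m + (a : ℂ) • n)) (datumRep g) := fun a ha =>
    isDirectSolution_iff_eq_inverse (hmn a) (hunit a ha) g
  have hfield : ContDiffOn ℝ ∞ (fieldMap Ω k g κ₀ D) I := by
    intro a ha
    have hu := hunit a ha
    rw [maxwellOp_add_smul] at hu
    refine (ContinuousLinearMap.contDiffAt_inverse_add_smul_apply (datumRep g)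
      hu).contDiffWithinAt.congr (fun b hb => ?_) ?_
    · rw [← maxwellOp_add_smul]
      exact directSolution_eq (hsol b hb)
    · rw [← maxwellOp_add_smul]
      exact directSolution_eq (hsol a ha)
  set T : HCurl Ω →L[ℝ] TraceSpace Ω := (tangentialTraceL Ω).restrictScalars ℝ
  refine ⟨fun a ha => ⟨_, (hsol a ha _).2 rfl, fun E => (hsol a ha E).1⟩, hfield,
    T.contDiff.comp_contDiffOn hfield, fun a ha n => ?_⟩
  -- Since `I` is open, smoothness on `I` is smoothness at `a`, as the unrestricted derivatives
  -- require.
  exact T.iteratedDeriv_comp_left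
    ((hfield.contDiffAt (hI_open.mem_nhds ha)).of_le (by exact_mod_cast le_top))

end
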